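/- Let $d\in\mathbb{N}$ and let $\mathcal{P}_d$ be the set of all probability distributions on $\mathbb{R}^d$ that admit a Lebesgue density of the form $f=\exp\circ\varphi$ for some concave function $\varphi:\mathbb{R}^d\to[-\infty,\infty)$. Let $P,P_1,P_2,P_3,\ldots\in\mathcal{P}_d$ have densities $f,f_1,f_2,f_3,\ldots$ of this form, respectively, and suppose that $P_n\to P$ weakly as $n\to\infty$. Let $\Theta(P)$ be the set of all $\theta\in\mathbb{R}^d$ such that $\int \exp(\theta^\top x)\,P(dx)<\infty$. Integrals of nonnegative functions below take values in $[0,\infty]$. Then for every $\theta\in\Theta(P)$ and every polynomial $\Pi:\mathbb{R}^d\to\mathbb{R}$ in $d$ variables, $$\lim_{n\to\infty}\int_{\mathbb{R}^d}\exp(\theta^\top x)\,|\Pi(x)|\,|f_n(x)-f(x)|\,dx=0 \quad\text{and}\quad \int_{\mathbb{R}^d}\exp(\theta^\top x)\,|\Pi(x)|\,f(x)\,dx<\infty .$$ Moreover, for every $\theta\in\mathbb{R}^d\setminus\Theta(P)$, $$\lim_{n\to\infty}\int_{\mathbb{R}^d}\exp(\theta^\top x)\,f_n(x)\,dx=\infty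 .$$ In particular, all moments converge: for every polynomial $\Pi$ in $d$ variables, $\Pi f$ and all $\Pi f_n$ are integrable and $\int \Pi(x)f_n(x)\,dx\to\int\Pi(x)f(x)\,dx$. Also the Laplace transforms converge pointwise: for every $\theta\in\mathbb{R}^d$, $\int\exp(\theta^\top x)f_n(x)\,dx\to\int\exp(\theta^\top x)f(x)\,dx$ in $[0,\infty]$. -/

import Mathlib

open MeasureTheory Filter Topology
open scoped ENNReal

/-- Concavity of a function `φ : ℝᵈ → [-∞, ∞)`, with the usual conventions of convex analysis:
`0 * (-∞) = 0` and `-∞ + t = -∞` (these are the conventions of `EReal`). -/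
def ExtendedConcave {d : ℕ} (φ : EuclideanSpace ℝ (Fin d) → EReal) : Prop :=
  (∀ x, φ x < ⊤) ∧
    ∀ (x y : EuclideanSpace ℝ (Fin d)) (a b : ℝ), 0 ≤ a → 0 ≤ b → a + b = 1 →
      (a : EReal) * φ x + (b : EReal) * φ y ≤ φ (a • x + b • y)

/-- `f = exp ∘ φ` for some concave function `φ : ℝᵈ → [-∞, ∞)`, where `exp (-∞) = 0`. -/
def LogConcaveFun {d : ℕ} (f : EuclideanSpace ℝ (Fin d) → ℝ) : Prop :=
  ∃ φ : EuclideanSpace ℝ (Fin d) → EReal,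
    ExtendedConcave φ ∧ ∀ x, f x = (EReal.exp (φ x)).toReal

/-- `P` belongs to the class of probability distributions on `ℝᵈ` with a log-concave Lebesgue
density, and `f` is such a density of `P`. -/
def HasLogConcaveDensity {d : ℕ} (P : ProbabilityMeasure (EuclideanSpace ℝ (Fin d)))
    (f : EuclideanSpace ℝ (Fin d) → ℝ) : Prop :=
  LogConcaveFun f ∧
    (P : Measure (EuclideanSpace ℝ (Fin d))) = volume.withDensity (fun x => ENNReal.ofReal (f x))

/-- The domain `Θ(P)` of the moment generating function of `P`: all `θ` such that
`∫ exp (θᵀ x) P(dx) < ∞`. -/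
def mgfDomain {d : ℕ} (P : ProbabilityMeasure (EuclideanSpace ℝ (Fin d))) :
    Set (EuclideanSpace ℝ (Fin d)) :=
  {θ | ∫⁻ x, ENNReal.ofReal (Real.exp (inner ℝ θ x))
    ∂(P : Measure (EuclideanSpace ℝ (Fin d))) < ∞}

/-! Log-concavity upgrades weak convergence in two ways.

Pointwise: where `f` exceeds a level near a point, the portmanteau theorem makes the superlevel set
of `fn` meet many small balls there. That set is convex, so it contains a fixed ball
(`eventually_lt_of_tendsto`). Hence liminf `fn` ≥ `f` almost everywhere, and Scheffé's argument
gives L¹ convergence (`tendsto_integral_abs_sub`).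

At infinity: for θ in the mgf domain the tilted densities exp(θᵀx) `fn` are log-concave and converge
in L¹ on bounded sets to an integrable limit. Small mass far out forces small values on a large
sphere, and log-concavity along rays turns this into exponential decay with constants independent of
n (`exists_eventually_le_mul_exp_neg_dist`). This majorant absorbs polynomials, and dominated
convergence concludes. Outside the domain, Fatou's lemma with the pointwise bound suffices. -/

/-- A nonnegative real-valued log-concave function on a real vector space. -/
structure IsLogConcave {E : Type*} [AddCommGroup E] [Module ℝ E] (f : E → ℝ) : Prop where
  nonneg : ∀ x, 0 ≤ f x
  rpow_mul_rpow_le : ∀ x y (a b : ℝ), 0 < a → 0 < b → a + b = 1 →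
    f x ^ a * f y ^ b ≤ f (a • x + b • y)

theorem LogConcaveFun.isLogConcave {d : ℕ} {f : EuclideanSpace ℝ (Fin d) → ℝ}
    (hf : LogConcaveFun f) : IsLogConcave f := by
  obtain ⟨φ, ⟨hlt, hφ⟩, hfφ⟩ := hf
  refine ⟨fun x => by rw [hfφ]; exact ENNReal.toReal_nonneg, fun x y a b ha hb hab => ?_⟩
  have key : ∀ z, φ z = ⊥ ∧ f z = 0 ∨ ∃ r : ℝ, φ z = r ∧ f z = Real.exp r := by
    intro z
    rw [hfφ z]
    have hz := (hlt z).ne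
    induction hw : φ z with
    | bot => simp
    | top => exact absurd hw hz
    | coe r => exact Or.inr ⟨r, rfl, by simp [Real.exp_nonneg]⟩
  have hnn : 0 ≤ f (a • x + b • y) := by rw [hfφ]; exact ENNReal.toReal_nonneg
  rcases key x with ⟨-, hx⟩ | ⟨r, hr, hx⟩
  · rwa [hx, Real.zero_rpow ha.ne', zero_mul]
  rcases key y with ⟨-, hy⟩ | ⟨s, hs, hy⟩
  · rwa [hy, Real.zero_rpow hb.ne', mul_zero]
  have h := hφ x y a b ha.le hb.le hab
  rw [hr, hs, ← EReal.coe_mul, ← EReal.coe_mul, ← EReal.coe_add] at h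
  rcases key (a • x + b • y) with ⟨hz, -⟩ | ⟨t, ht, hz⟩
  · rw [hz] at h
    exact absurd (le_bot_iff.1 h) (EReal.coe_ne_bot _)
  · rw [ht, EReal.coe_le_coe_iff] at h
    rw [hz, hx, hy, ← Real.exp_mul, ← Real.exp_mul, ← Real.exp_add]
    exact Real.exp_le_exp.2 (by linarith)

/-! ### Algebra and regularity of log-concave functions. -/

namespace IsLogConcave

section Algebra

variable {E : Type*} [AddCommGroup E] [Module ℝ E] {f : E → ℝ}

theorem lt_of_lt_of_lt (hf : IsLogConcave f) {t : ℝ} (ht : 0 ≤ t) {x y : E} (hx : t < f x)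
    (hy : t < f y) {a b : ℝ} (ha : 0 < a) (hb : 0 < b) (hab : a + b = 1) :
    t < f (a • x + b • y) := by
  refine lt_of_lt_of_le ?_ (hf.rpow_mul_rpow_le x y a b ha hb hab)
  have h1 : t ^ a < f x ^ a := Real.rpow_lt_rpow ht hx ha
  have h2 : t ^ b < f y ^ b := Real.rpow_lt_rpow ht hy hb
  calc t = t ^ a * t ^ b := by
        rw [← Real.rpow_add_of_nonneg ht ha.le hb.le, hab, Real.rpow_one]
    _ < f x ^ a * f y ^ b :=
        mul_lt_mul'' h1 h2 (Real.rpow_nonneg ht _) (Real.rpow_nonneg ht _)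

theorem convex_setOf_lt (hf : IsLogConcave f) {t : ℝ} (ht : 0 ≤ t) : Convex ℝ {x | t < f x} :=
  convex_iff_forall_pos.2 fun _ hx _ hy _ _ ha hb hab => hf.lt_of_lt_of_lt ht hx hy ha hb hab

theorem concaveOn_log (hf : IsLogConcave f) :
    ConcaveOn ℝ {x | 0 < f x} (fun x => Real.log (f x)) := by
  refine concaveOn_iff_forall_pos.2 ⟨hf.convex_setOf_lt le_rfl, ?_⟩
  intro x hx y hy a b ha hb hab
  have hx' : 0 < f x := hx
  have hy' : 0 < f y := hy
  have h := Real.log_le_log (by positivity) (hf.rpow_mul_rpow_le x y a b ha hb hab)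
  rwa [Real.log_mul (by positivity) (by positivity), Real.log_rpow hx', Real.log_rpow hy'] at h

theorem mul {g : E → ℝ} (hf : IsLogConcave f) (hg : IsLogConcave g) :
    IsLogConcave (fun x => f x * g x) := by
  refine ⟨fun x => mul_nonneg (hf.nonneg x) (hg.nonneg x), fun x y a b ha hb hab => ?_⟩
  rw [Real.mul_rpow (hf.nonneg x) (hg.nonneg x), Real.mul_rpow (hf.nonneg y) (hg.nonneg y)]
  calc _ = (f x ^ a * f y ^ b) * (g x ^ a * g y ^ b) := by ring
    _ ≤ _ := mul_le_mul (hf.rpow_mul_rpow_le x y a b ha hb hab)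
        (hg.rpow_mul_rpow_le x y a b ha hb hab)
        (mul_nonneg (Real.rpow_nonneg (hg.nonneg x) _) (Real.rpow_nonneg (hg.nonneg y) _))
        (hf.nonneg _)

end Algebra

theorem exp_inner {E : Type*} [NormedAddCommGroup E] [InnerProductSpace ℝ E] (θ : E) :
    IsLogConcave (fun x => Real.exp (inner ℝ θ x)) := by
  refine ⟨fun x => (Real.exp_pos _).le, fun x y a b _ _ _ => ?_⟩
  rw [← Real.exp_mul, ← Real.exp_mul, ← Real.exp_add, inner_add_right, inner_smul_right,
    inner_smul_right, mul_comm a, mul_comm b]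

section Topology

variable {E : Type*} [NormedAddCommGroup E] [NormedSpace ℝ E] [FiniteDimensional ℝ E] {f : E → ℝ}

/-- The concave function log `f` is continuous in the interior of its domain, the dimension being
finite. -/
theorem continuousOn_interior (hf : IsLogConcave f) :
    ContinuousOn f (interior {x | 0 < f x}) := by
  refine (Real.continuous_exp.comp_continuousOn hf.concaveOn_log.continuousOn_interior).congr ?_
  intro x hx
  exact (Real.exp_log (interior_subset (s := {x | 0 < f x}) hx)).symm

variable [MeasurableSpace E] [BorelSpace E] (μ : Measure E) [μ.IsAddHaarMeasure]

/-- The positivity set is convex, so its frontier is a null set. -/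
theorem ae_mem_interior (hf : IsLogConcave f) :
    ∀ᵐ x ∂μ, 0 < f x → x ∈ interior {x | 0 < f x} := by
  have h := (hf.convex_setOf_lt le_rfl).addHaar_frontier μ
  filter_upwards [measure_eq_zero_iff_ae_notMem.1 h] with x hx hpos
  by_contra hcon
  exact hx ⟨subset_closure hpos, hcon⟩

/-- Borel measurability can fail on the frontier: a function equal to 1 on an open Euclidean disc, 0
off its closure, and arbitrary in [0, 1] on the circle is log-concave. -/
theorem aemeasurable (hf : IsLogConcave f) : AEMeasurable f μ := by
  have h1 : AEMeasurable ((interior {x | 0 < f x}).indicator f) μ :=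
    (aemeasurable_indicator_iff isOpen_interior.measurableSet).2
      (hf.continuousOn_interior.aemeasurable isOpen_interior.measurableSet)
  refine h1.congr ?_
  filter_upwards [hf.ae_mem_interior μ] with x hx
  by_cases hpos : 0 < f x
  · exact Set.indicator_of_mem (hx hpos) f
  · rw [Set.indicator_of_notMem (fun h => hpos (interior_subset (s := {x | 0 < f x}) h))]
    exact le_antisymm (hf.nonneg x) (not_lt.1 hpos)

end Topology

end IsLogConcave

/-! ### Convex sets meeting many small balls. -/

section Convex

variable {E : Type*} [NormedAddCommGroup E] [NormedSpace ℝ E]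

/-- A convex set which meets all the balls of radius `r / 2` centred in a ball of radius `2 * r`
contains the concentric ball of radius `r`, up to closure. -/
theorem Convex.ball_subset_closure_of_meets_balls {S : Set E} (hS : Convex ℝ S) {x₀ : E} {r : ℝ}
    (h : ∀ v ∈ Metric.closedBall x₀ (2 * r), ∃ s ∈ S, dist s v < r / 2) :
    Metric.ball x₀ r ⊆ closure S := by
  intro y hy
  by_contra hcon
  have hr : 0 < r := dist_nonneg.trans_lt hy
  obtain ⟨u, c, hu, hc⟩ := geometric_hahn_banach_closed_point hS.closure isClosed_closure hcon
  have hune : u ≠ 0 := by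
    rintro rfl
    obtain ⟨s, hs, -⟩ := h x₀ (Metric.mem_closedBall_self (by positivity))
    have := hu s (subset_closure hs)
    simp only [_root_.zero_apply] at this hc
    linarith
  have hn : 0 < ‖u‖ := norm_pos_iff.2 hune
  -- Going from `y` to `y + r • e'` raises `u` by more than `r * ‖u‖ / 2`. A point of `S` within `r
  -- / 2` of the endpoint loses at most that, so `u` there exceeds `u y`, against the separation.
  obtain ⟨e, he1, he2⟩ := u.exists_lt_apply_of_lt_opNorm (half_lt_self hn)
  obtain ⟨e', he1', he2'⟩ : ∃ e' : E, ‖e'‖ < 1 ∧ ‖u‖ / 2 < u e' := by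
    rcases abs_cases (u e) with h' | h'
    · exact ⟨e, he1, by rw [Real.norm_eq_abs, h'.1] at he2; exact he2⟩
    · exact ⟨-e, by rwa [norm_neg], by rw [Real.norm_eq_abs, h'.1] at he2; rwa [map_neg]⟩
  obtain ⟨s, hs, hd⟩ := h (y + r • e') (by
    rw [Metric.mem_closedBall, dist_eq_norm]
    have h1 : ‖y - x₀‖ < r := by rwa [← dist_eq_norm]
    have h2 : ‖r • e'‖ ≤ r := by
      rw [norm_smul, Real.norm_of_nonneg hr.le]; nlinarith [norm_nonneg e']
    calc ‖y + r • e' - x₀‖ = ‖(y - x₀) + r • e'‖ := by congr 1; abel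
      _ ≤ ‖y - x₀‖ + ‖r • e'‖ := norm_add_le _ _
      _ ≤ 2 * r := by linarith)
  have h3 : u (s - (y + r • e')) = u s - (u y + r * u e') := by
    rw [map_sub, map_add, map_smul, smul_eq_mul]
  have h4 : |u (s - (y + r • e'))| ≤ ‖u‖ * (r / 2) :=
    (u.le_opNorm _).trans (mul_le_mul_of_nonneg_left (by rw [← dist_eq_norm]; exact hd.le) hn.le)
  have h5 := (abs_le.1 h4).1
  have h6 := hu s (subset_closure hs)
  have h7 : r * (‖u‖ / 2) < r * u e' := mul_lt_mul_of_pos_left he2' hr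
  rw [h3] at h5
  linarith

/-- If `closure S` contains a ball, then `S` affinely spans the space and so has interior points; a
convex set with interior points has the same interior as its closure. -/
theorem Convex.ball_subset_of_meets_balls [FiniteDimensional ℝ E] {S : Set E} (hS : Convex ℝ S)
    {x₀ : E} {r : ℝ} (h : ∀ v ∈ Metric.closedBall x₀ (2 * r), ∃ s ∈ S, dist s v < r / 2) :
    Metric.ball x₀ r ⊆ S := by
  have hsub := hS.ball_subset_closure_of_meets_balls h
  rcases (Metric.ball x₀ r).eq_empty_or_nonempty with he | hne
  · simp [he]
  have hint : (interior S).Nonempty := by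
    by_contra hemp
    have hspan : affineSpan ℝ S ≠ ⊤ := fun h' => hemp
      (hS.interior_nonempty_iff_affineSpan_eq_top.2 h')
    refine hspan (top_le_iff.1 ?_)
    have hcl : IsClosed (affineSpan ℝ S : Set E) := AffineSubspace.closed_of_finiteDimensional _
    have h1 : Metric.ball x₀ r ⊆ affineSpan ℝ S :=
      hsub.trans (closure_minimal (subset_affineSpan ℝ S) hcl)
    rw [← Metric.isOpen_ball.affineSpan_eq_top hne]
    exact affineSpan_le.2 h1
  calc Metric.ball x₀ r ⊆ interior (closure S) := interior_maximal hsub Metric.isOpen_ball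
    _ = interior S := hS.interior_closure_eq_interior_of_nonempty_interior hint
    _ ⊆ S := interior_subset

end Convex

/-! ### From weak convergence to L¹ convergence of the densities. -/

section WeakConvergence

variable {E : Type*} [NormedAddCommGroup E] [NormedSpace ℝ E] [FiniteDimensional ℝ E]
  [MeasurableSpace E] [BorelSpace E] {μ : Measure E} [μ.IsAddHaarMeasure]
  {P : ProbabilityMeasure E} {Pn : ℕ → ProbabilityMeasure E} {f : E → ℝ} {fn : ℕ → E → ℝ}

theorem integrable_of_eq_withDensity (hf : IsLogConcave f)
    (hP : (P : Measure E) = μ.withDensity fun x => ENNReal.ofReal (f x)) : Integrable f μ := by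
  refine ⟨(hf.aemeasurable μ).aestronglyMeasurable, ?_⟩
  rw [hasFiniteIntegral_iff_ofReal (Eventually.of_forall hf.nonneg), ← setLIntegral_univ,
    ← withDensity_apply _ MeasurableSet.univ, ← hP, measure_univ]
  exact ENNReal.one_lt_top

theorem integral_eq_one_of_eq_withDensity (hf : IsLogConcave f)
    (hP : (P : Measure E) = μ.withDensity fun x => ENNReal.ofReal (f x)) : ∫ x, f x ∂μ = 1 := by
  rw [integral_eq_lintegral_of_nonneg_ae (Eventually.of_forall hf.nonneg)
    (hf.aemeasurable μ).aestronglyMeasurable, ← setLIntegral_univ,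
    ← withDensity_apply _ MeasurableSet.univ, ← hP, measure_univ, ENNReal.toReal_one]

/-- Along a weakly convergent sequence of log-concave distributions, lower bounds for the limit
density on a ball persist on a smaller ball. -/
theorem eventually_lt_of_tendsto (hfn : ∀ n, IsLogConcave (fn n))
    (hP : (P : Measure E) = μ.withDensity fun x => ENNReal.ofReal (f x))
    (hPn : ∀ n, (Pn n : Measure E) = μ.withDensity fun x => ENNReal.ofReal (fn n x))
    (hweak : Tendsto Pn atTop (𝓝 P)) {x₀ : E} {r s t : ℝ} (hr : 0 < r) (hs : 0 ≤ s) (hst : s < t)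
    (hlow : ∀ x ∈ Metric.ball x₀ (3 * r), t ≤ f x) :
    ∀ᶠ n in atTop, ∀ x ∈ Metric.ball x₀ r, s < fn n x := by
  -- If `fn n ≤ s` on the whole small ball, its mass would be at most `s` times its volume, whereas
  -- the limit mass is at least `t` times the volume.
  have hpoint : ∀ v ∈ Metric.closedBall x₀ (2 * r),
      ∀ᶠ n in atTop, ∃ y ∈ Metric.ball v (r / 4), s < fn n y := by
    intro v hv
    have hsub : Metric.ball v (r / 4) ⊆ Metric.ball x₀ (3 * r) :=
      Metric.ball_subset_ball' (by have := Metric.mem_closedBall.1 hv; linarith)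
    have hV0 : μ (Metric.ball v (r / 4)) ≠ 0 := (Metric.measure_ball_pos μ v (by positivity)).ne'
    have hVt : μ (Metric.ball v (r / 4)) ≠ ∞ := measure_ball_lt_top.ne
    have h1 : ENNReal.ofReal s * μ (Metric.ball v (r / 4)) <
        (P : Measure E) (Metric.ball v (r / 4)) := by
      calc ENNReal.ofReal s * μ (Metric.ball v (r / 4))
          < ENNReal.ofReal t * μ (Metric.ball v (r / 4)) :=
            (ENNReal.mul_lt_mul_iff_left hV0 hVt).2
              ((ENNReal.ofReal_lt_ofReal_iff (hs.trans_lt hst)).2 hst)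
        _ = ∫⁻ _ in Metric.ball v (r / 4), ENNReal.ofReal t ∂μ := by
            rw [setLIntegral_const]
        _ ≤ ∫⁻ x in Metric.ball v (r / 4), ENNReal.ofReal (f x) ∂μ :=
            setLIntegral_mono' measurableSet_ball fun x hx =>
              ENNReal.ofReal_le_ofReal (hlow x (hsub hx))
        _ = _ := by rw [hP, withDensity_apply _ measurableSet_ball]
    have h2 := eventually_lt_of_lt_liminf (h1.trans_le
      (ProbabilityMeasure.le_liminf_measure_open_of_tendsto hweak
        (Metric.isOpen_ball (x := v) (ε := r / 4))))
    filter_upwards [h2] with n hn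
    by_contra! hcon
    refine hn.not_ge ?_
    rw [hPn, withDensity_apply _ measurableSet_ball]
    calc ∫⁻ x in Metric.ball v (r / 4), ENNReal.ofReal (fn n x) ∂μ
        ≤ ∫⁻ _ in Metric.ball v (r / 4), ENNReal.ofReal s ∂μ :=
          setLIntegral_mono' measurableSet_ball fun x hx => ENNReal.ofReal_le_ofReal (hcon x hx)
      _ = _ := by rw [setLIntegral_const]
  have := FiniteDimensional.proper_real E
  -- Compactness leaves finitely many test balls, so one threshold on n serves all. Two distances
  -- below `r / 4` add up to the `r / 2` of the convexity lemma.
  obtain ⟨F, hF, hcover⟩ := (isCompact_closedBall x₀ (2 * r)).elim_nhds_subcover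
    (fun v => Metric.ball v (r / 4)) (fun v _ => Metric.ball_mem_nhds v (by positivity))
  have hall : ∀ᶠ n in atTop, ∀ v ∈ F, ∃ y ∈ Metric.ball v (r / 4), s < fn n y :=
    (F.eventually_all).2 fun v hv => hpoint v (hF v hv)
  filter_upwards [hall] with n hn
  refine ((hfn n).convex_setOf_lt hs).ball_subset_of_meets_balls fun v hv => ?_
  obtain ⟨w, hwF, hvw⟩ := Set.mem_iUnion₂.1 (hcover hv)
  obtain ⟨y, hy, hys⟩ := hn w hwF
  refine ⟨y, hys, ?_⟩
  have h1 := Metric.mem_ball.1 hy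
  have h2 := Metric.mem_ball'.1 hvw
  linarith [dist_triangle y w v]

/-- The negative parts of `fn n - f` tend to zero almost everywhere. -/
theorem ae_tendsto_max_sub_zero (hf : IsLogConcave f) (hfn : ∀ n, IsLogConcave (fn n))
    (hP : (P : Measure E) = μ.withDensity fun x => ENNReal.ofReal (f x))
    (hPn : ∀ n, (Pn n : Measure E) = μ.withDensity fun x => ENNReal.ofReal (fn n x))
    (hweak : Tendsto Pn atTop (𝓝 P)) :
    ∀ᵐ x ∂μ, Tendsto (fun n => max (f x - fn n x) 0) atTop (𝓝 0) := by
  filter_upwards [hf.ae_mem_interior μ] with x hx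
  rcases (hf.nonneg x).eq_or_lt with h0 | hpos
  · refine tendsto_const_nhds.congr fun n => ?_
    rw [max_eq_right]
    linarith [(hfn n).nonneg x]
  refine tendsto_order.2 ⟨fun a ha => Eventually.of_forall fun n => ha.trans_le (le_max_right _ _),
    fun ε hε => ?_⟩
  have hc : ContinuousAt f x := hf.continuousOn_interior.continuousAt
    (isOpen_interior.mem_nhds (hx hpos))
  -- Truncation at 0, because only superlevel sets at nonnegative levels are known to be convex.
  have hlt : max (f x - ε) 0 < f x := max_lt (by linarith) hpos
  obtain ⟨t, ht1, ht2⟩ := exists_between hlt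
  obtain ⟨δ, hδ, hball⟩ := Metric.eventually_nhds_iff_ball.1 (hc.eventually (lt_mem_nhds ht2))
  have h := eventually_lt_of_tendsto hfn hP hPn hweak (x₀ := x) (r := δ / 3) (by positivity)
    (le_max_right _ _) ht1 (fun y hy => (hball y (by convert hy using 2; ring)).le)
  filter_upwards [h] with n hn
  have := (le_max_left _ _).trans_lt (hn x (Metric.mem_ball_self (by positivity)))
  exact max_lt (by linarith) hε

/-- **Scheffé**: weak convergence of log-concave distributions implies convergence of the
densities in `L¹`. -/
theorem tendsto_integral_abs_sub (hf : IsLogConcave f) (hfn : ∀ n, IsLogConcave (fn n))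
    (hP : (P : Measure E) = μ.withDensity fun x => ENNReal.ofReal (f x))
    (hPn : ∀ n, (Pn n : Measure E) = μ.withDensity fun x => ENNReal.ofReal (fn n x))
    (hweak : Tendsto Pn atTop (𝓝 P)) :
    Tendsto (fun n => ∫ x, |fn n x - f x| ∂μ) atTop (𝓝 0) := by
  have hi := integrable_of_eq_withDensity hf hP
  have hin := fun n => integrable_of_eq_withDensity (hfn n) (hPn n)
  have hpos : ∀ n, Integrable (fun x => max (f x - fn n x) 0) μ := fun n => (hi.sub (hin n)).pos_part
  have h1 : Tendsto (fun n => ∫ x, max (f x - fn n x) 0 ∂μ) atTop (𝓝 (∫ _, (0 : ℝ) ∂μ)) := by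
    refine tendsto_integral_of_dominated_convergence f (fun n => (hpos n).aestronglyMeasurable) hi
      (fun n => Eventually.of_forall fun x => ?_) (ae_tendsto_max_sub_zero hf hfn hP hPn hweak)
    rw [Real.norm_of_nonneg (le_max_right _ _)]
    exact max_le (by linarith [(hfn n).nonneg x]) (hf.nonneg x)
  rw [integral_zero] at h1
  -- |g - f| = 2 (f - g)⁺ + (g - f), and the last term has integral zero. Only (f - g)⁺ has the
  -- majorant `f`.
  have h2 : ∀ n, ∫ x, |fn n x - f x| ∂μ = 2 * ∫ x, max (f x - fn n x) 0 ∂μ := by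
    intro n
    have h3 : ∫ x, (fn n x - f x) ∂μ = 0 := by
      rw [integral_sub (hin n) hi, integral_eq_one_of_eq_withDensity hf hP,
        integral_eq_one_of_eq_withDensity (hfn n) (hPn n), sub_self]
    calc ∫ x, |fn n x - f x| ∂μ
        = ∫ x, (2 * max (f x - fn n x) 0 + (fn n x - f x)) ∂μ := by
          congr 1 with x
          rcases le_total (fn n x) (f x) with h | h
          · rw [max_eq_left (by linarith), abs_of_nonpos (by linarith)]; ring
          · rw [max_eq_right (by linarith), abs_of_nonneg (by linarith)]; ring
      _ = 2 * ∫ x, max (f x - fn n x) 0 ∂μ := by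
          have h4 : Integrable (fun x => fn n x - f x) μ := (hin n).sub hi
          rw [integral_add ((hpos n).const_mul 2) h4, h3, add_zero,
            integral_const_mul]
  simp_rw [h2]
  simpa using h1.const_mul 2

/-- A log-concave probability density is positive, and bounded away from zero, on some ball. -/
theorem exists_ball_le_of_eq_withDensity (hf : IsLogConcave f)
    (hP : (P : Measure E) = μ.withDensity fun x => ENNReal.ofReal (f x)) :
    ∃ (x₀ : E) (r t : ℝ), 0 < r ∧ 0 < t ∧ ∀ x ∈ Metric.ball x₀ r, t ≤ f x := by
  obtain ⟨x₀, hx₀⟩ : ∃ x, x ∈ interior {x | 0 < f x} := by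
    by_contra! hcon
    have h0 : f =ᵐ[μ] 0 := by
      filter_upwards [hf.ae_mem_interior μ] with x hx
      by_contra h
      exact hcon x (hx ((hf.nonneg x).lt_of_ne' h))
    have := integral_eq_one_of_eq_withDensity hf hP
    rw [integral_congr_ae h0] at this
    simp at this
  have hpos : 0 < f x₀ := interior_subset (s := {x | 0 < f x}) hx₀
  have hc : ContinuousAt f x₀ := hf.continuousOn_interior.continuousAt
    (isOpen_interior.mem_nhds hx₀)
  obtain ⟨δ, hδ, hball⟩ := Metric.eventually_nhds_iff_ball.1
    (hc.eventually (lt_mem_nhds (half_lt_self hpos)))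
  exact ⟨x₀, δ, f x₀ / 2, hδ, half_pos hpos, fun x hx => (hball x hx).le⟩

end WeakConvergence

/-! ### A common exponential majorant. -/

namespace IsLogConcave

section Domination

variable {E : Type*} [NormedAddCommGroup E] [NormedSpace ℝ E] {h : E → ℝ}

theorem sqrt_mul_le (hh : IsLogConcave h) (x y : E) :
    √(h x) * √(h y) ≤ h ((1 / 2 : ℝ) • x + (1 / 2 : ℝ) • y) := by
  have := hh.rpow_mul_rpow_le x y (1 / 2) (1 / 2) (by norm_num) (by norm_num) (by norm_num)
  rwa [← Real.sqrt_eq_rpow, ← Real.sqrt_eq_rpow] at this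

/-- The value of a log-concave function at a point is controlled by its integral over a ball
halfway between this point and a ball on which the function is bounded from below. -/
theorem sqrt_mul_measure_le_setIntegral [FiniteDimensional ℝ E] [MeasurableSpace E] [BorelSpace E]
    {μ : Measure E} [μ.IsAddHaarMeasure] (hh : IsLogConcave h) (hint : LocallyIntegrable h μ)
    {x₀ : E} {r δ : ℝ} (hlow : ∀ y ∈ Metric.ball x₀ r, δ ≤ h y) (x : E) :
    √(h x) * √δ * μ.real (Metric.ball 0 (r / 2)) ≤
      ∫ y in Metric.ball ((1 / 2 : ℝ) • x + (1 / 2 : ℝ) • x₀) (r / 2), h y ∂μ := by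
  have := FiniteDimensional.proper_real E
  have hI : IntegrableOn h (Metric.ball ((1 / 2 : ℝ) • x + (1 / 2 : ℝ) • x₀) (r / 2)) μ :=
    (hint.integrableOn_isCompact (isCompact_closedBall _ _)).mono_set Metric.ball_subset_closedBall
  have hV : μ.real (Metric.ball 0 (r / 2)) =
      μ.real (Metric.ball ((1 / 2 : ℝ) • x + (1 / 2 : ℝ) • x₀) (r / 2)) := by
    rw [Measure.real, Measure.real,
      Measure.addHaar_ball_center μ ((1 / 2 : ℝ) • x + (1 / 2 : ℝ) • x₀)]
  rw [hV, mul_comm, ← smul_eq_mul, ← setIntegral_const]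
  refine setIntegral_mono_on (integrableOn_const measure_ball_lt_top.ne) hI measurableSet_ball
    fun y hy => ?_
  -- Reflection of `x` in `y`: it lies in the ball about `x₀` because `y` is within `r / 2` of the
  -- midpoint of `x` and `x₀`.
  set z : E := (2 : ℝ) • y - x with hz
  have hyz : (1 / 2 : ℝ) • x + (1 / 2 : ℝ) • z = y := by rw [hz]; module
  have hzb : z ∈ Metric.ball x₀ r := by
    have h1 : z - x₀ = (2 : ℝ) • (y - ((1 / 2 : ℝ) • x + (1 / 2 : ℝ) • x₀)) := by rw [hz]; module
    rw [Metric.mem_ball, dist_eq_norm] at hy ⊢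
    rw [h1, norm_smul, Real.norm_of_nonneg (by norm_num)]
    linarith
  calc √(h x) * √δ ≤ √(h x) * √(h z) :=
        mul_le_mul_of_nonneg_left (Real.sqrt_le_sqrt (hlow z hzb)) (Real.sqrt_nonneg _)
    _ ≤ h y := by have := hh.sqrt_mul_le x z; rwa [hyz] at this

/-- A log-concave function that is small on a sphere, in comparison with its value at the centre,
decays exponentially. -/
theorem le_mul_exp_neg_dist (hh : IsLogConcave h) {x₀ : E} {R δ M : ℝ} (hR : 0 < R) (hδ : 0 < δ)
    (hδM : δ ≤ M) (h0 : δ ≤ h x₀) (hsphere : ∀ z, dist z x₀ = R → h z ≤ δ / 4)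
    (hball : ∀ z ∈ Metric.closedBall x₀ R, h z ≤ M) (x : E) :
    h x ≤ 4 * M * Real.exp (-(Real.log 4 / R) * dist x x₀) := by
  have hlog : 0 < Real.log 4 := Real.log_pos (by norm_num)
  have hM : 0 < M := hδ.trans_le hδM
  rcases le_or_gt (dist x x₀) R with hx | hx
  · have h1 : Real.exp (-(Real.log 4)) ≤ Real.exp (-(Real.log 4 / R) * dist x x₀) := by
      refine Real.exp_le_exp.2 ?_
      have : Real.log 4 / R * dist x x₀ ≤ Real.log 4 / R * R :=
        mul_le_mul_of_nonneg_left hx (by positivity)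
      rw [div_mul_cancel₀ _ hR.ne'] at this
      linarith
    rw [Real.exp_neg, Real.exp_log (by norm_num)] at h1
    have h2 := hball x hx
    nlinarith
  rcases (hh.nonneg x).eq_or_lt with hx0 | hxpos
  · rw [← hx0]; positivity
  have hρ : 0 < dist x x₀ := hR.trans hx
  -- The ratio for which the point `s • x + (1 - s) • x₀` of the segment lies on the sphere.
  set s := R / dist x x₀ with hs
  have hs0 : 0 < s := by positivity
  have hs1 : s < 1 := (div_lt_one hρ).2 hx
  have hz : dist (s • x + (1 - s) • x₀) x₀ = R := by
    have h1 : s • x + (1 - s) • x₀ - x₀ = s • (x - x₀) := by module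
    rw [dist_eq_norm, h1, norm_smul, Real.norm_of_nonneg hs0.le, ← dist_eq_norm, hs,
      div_mul_cancel₀ _ hρ.ne']
  have h1 := (hh.rpow_mul_rpow_le x x₀ s (1 - s) hs0 (by linarith) (by ring)).trans (hsphere _ hz)
  have h0pos : 0 < h x₀ := hδ.trans_le h0
  have h2 := Real.log_le_log (by positivity) h1
  rw [Real.log_mul (by positivity) (by positivity), Real.log_rpow hxpos, Real.log_rpow h0pos,
    Real.log_div hδ.ne' (by norm_num)] at h2
  have h3 : Real.log δ ≤ Real.log (h x₀) := Real.log_le_log hδ h0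
  have h4 : s * (Real.log (h x) - Real.log δ) ≤ -Real.log 4 := by nlinarith
  have h5 : Real.log (h x) ≤ Real.log δ + -(Real.log 4 / R) * dist x x₀ := by
    have : Real.log (h x) - Real.log δ ≤ -Real.log 4 / s := by
      rw [le_div_iff₀ hs0]; linarith
    have h6 : -Real.log 4 / s = -(Real.log 4 / R) * dist x x₀ := by
      rw [hs]; field_simp
    linarith
  calc h x = Real.exp (Real.log (h x)) := (Real.exp_log hxpos).symm
    _ ≤ Real.exp (Real.log δ + -(Real.log 4 / R) * dist x x₀) := Real.exp_le_exp.2 h5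
    _ = δ * Real.exp (-(Real.log 4 / R) * dist x x₀) := by rw [Real.exp_add, Real.exp_log hδ]
    _ ≤ _ := mul_le_mul_of_nonneg_right (by linarith) (Real.exp_pos _).le

/-- A sequence of log-concave functions which converges in `L¹` on bounded sets to an integrable
function, and which is bounded from below on some ball, has a common exponential majorant. -/
theorem exists_eventually_le_mul_exp_neg_dist [FiniteDimensional ℝ E] [MeasurableSpace E]
    [BorelSpace E] {μ : Measure E} [μ.IsAddHaarMeasure] {hn : ℕ → E → ℝ}
    (hh : Integrable h μ) (hpos : ∀ x, 0 ≤ h x) (hhn : ∀ n, IsLogConcave (hn n))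
    (hint : ∀ n, LocallyIntegrable (hn n) μ) {x₀ : E} {r δ : ℝ} (hr : 0 < r) (hδ : 0 < δ)
    (hlow : ∀ᶠ n in atTop, ∀ y ∈ Metric.ball x₀ r, δ ≤ hn n y)
    (hlim : ∀ K, Tendsto (fun n => ∫ y in Metric.closedBall x₀ K, |hn n y - h y| ∂μ) atTop (𝓝 0)) :
    ∃ C c : ℝ, 0 < C ∧ 0 < c ∧
      ∀ᶠ n in atTop, ∀ x, hn n x ≤ C * Real.exp (-c * dist x x₀) := by
  have := FiniteDimensional.proper_real E
  set V := μ.real (Metric.ball (0 : E) (r / 2)) with hVdef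
  have hV : 0 < V := ENNReal.toReal_pos (Metric.measure_ball_pos μ 0 (by positivity)).ne'
    measure_ball_lt_top.ne
  have htail : ∃ k : ℕ, ∫ y in (Metric.closedBall x₀ (k : ℝ))ᶜ, h y ∂μ < δ * V / 4 := by
    have h1 := tendsto_setIntegral_of_antitone (μ := μ) (f := h)
      (s := fun k : ℕ => (Metric.closedBall x₀ (k : ℝ))ᶜ)
      (fun _ => Metric.isClosed_closedBall.measurableSet.compl)
      (fun i j hij => Set.compl_subset_compl.2
        (Metric.closedBall_subset_closedBall (Nat.cast_le.2 hij))) ⟨0, hh.integrableOn⟩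
    rw [← Set.compl_iUnion, Metric.iUnion_closedBall_nat, Set.compl_univ, setIntegral_empty] at h1
    exact (h1.eventually (gt_mem_nhds (by positivity))).exists
  obtain ⟨k, hk⟩ := htail
  -- A point at distance `R` from `x₀` has its half-way ball of radius `r / 2` outside the closed
  -- ball of radius `k`. None of `R`, `δ`, `M` depends on n.
  set R : ℝ := 2 * k + r + 1 with hRdef
  have hR : 0 < R := by positivity
  set I₀ : ℝ := ∫ y, h y ∂μ + δ * V / 4 with hI₀
  -- The second entry solves √M √δ V = `I₀`, where `I₀` bounds the integral of `hn n` over every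
  -- half-way ball in use.
  set M : ℝ := max δ ((I₀ / V) ^ 2 / δ) with hM
  refine ⟨4 * M, Real.log 4 / R, by positivity, div_pos (Real.log_pos (by norm_num)) hR, ?_⟩
  filter_upwards [hlow, (hlim R).eventually (gt_mem_nhds (show 0 < δ * V / 4 by positivity))]
    with n hn1 hn2
  have hc : ∀ x, dist ((1 / 2 : ℝ) • x + (1 / 2 : ℝ) • x₀) x₀ = dist x x₀ / 2 := by
    intro x
    have h1 : (1 / 2 : ℝ) • x + (1 / 2 : ℝ) • x₀ - x₀ = (1 / 2 : ℝ) • (x - x₀) := by module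
    rw [dist_eq_norm, h1, norm_smul, Real.norm_of_nonneg (by norm_num), ← dist_eq_norm]
    ring
  -- Replacing `hn n` by `h` on the half-way ball costs at most the L¹ error on the ball of radius
  -- `R`.
  have hdom : ∀ x ∈ Metric.closedBall x₀ R, √(hn n x) * √δ * V ≤
      ∫ y in Metric.ball ((1 / 2 : ℝ) • x + (1 / 2 : ℝ) • x₀) (r / 2), h y ∂μ + δ * V / 4 := by
    intro x hx
    have hsub : Metric.ball ((1 / 2 : ℝ) • x + (1 / 2 : ℝ) • x₀) (r / 2) ⊆
        Metric.closedBall x₀ R := by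
      refine Metric.ball_subset_closedBall.trans (Metric.closedBall_subset_closedBall' ?_)
      rw [hc]
      have h1 := Metric.mem_closedBall.1 hx
      have h2 : (0 : ℝ) ≤ k := k.cast_nonneg
      linarith
    have hi1 : IntegrableOn (hn n) (Metric.closedBall x₀ R) μ :=
      (hint n).integrableOn_isCompact (isCompact_closedBall _ _)
    have hi2 : IntegrableOn (fun y => |hn n y - h y|) (Metric.closedBall x₀ R) μ :=
      (hi1.sub hh.integrableOn).abs
    refine ((hhn n).sqrt_mul_measure_le_setIntegral (hint n) hn1 x).trans ?_
    calc ∫ y in Metric.ball ((1 / 2 : ℝ) • x + (1 / 2 : ℝ) • x₀) (r / 2), hn n y ∂μ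
        ≤ ∫ y in Metric.ball ((1 / 2 : ℝ) • x + (1 / 2 : ℝ) • x₀) (r / 2),
            (h y + |hn n y - h y|) ∂μ :=
          setIntegral_mono (hi1.mono_set hsub) (hh.integrableOn.add (hi2.mono_set hsub))
            fun y => by linarith [le_abs_self (hn n y - h y)]
      _ = ∫ y in Metric.ball ((1 / 2 : ℝ) • x + (1 / 2 : ℝ) • x₀) (r / 2), h y ∂μ +
            ∫ y in Metric.ball ((1 / 2 : ℝ) • x + (1 / 2 : ℝ) • x₀) (r / 2),
              |hn n y - h y| ∂μ := integral_add hh.integrableOn (hi2.mono_set hsub)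
      _ ≤ _ := by
          have := setIntegral_mono_set hi2 (Eventually.of_forall fun y => abs_nonneg _)
            hsub.eventuallyLE
          linarith
  have hbound : ∀ x a, 0 ≤ a → √(hn n x) * √δ * V ≤ a → hn n x ≤ (a / V) ^ 2 / δ := by
    intro x a ha hle
    rw [le_div_iff₀ hδ]
    have h1 : √(hn n x) * √δ ≤ a / V := (le_div_iff₀ hV).2 hle
    calc hn n x * δ = (√(hn n x) * √δ) ^ 2 := by
          rw [mul_pow, Real.sq_sqrt ((hhn n).nonneg x), Real.sq_sqrt hδ.le]
      _ ≤ _ := pow_le_pow_left₀ (by positivity) h1 2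
  refine (hhn n).le_mul_exp_neg_dist hR hδ (le_max_left _ _)
    (hn1 x₀ (Metric.mem_ball_self hr)) (fun z hz => ?_) (fun z hz => ?_)
  · have hsub : Metric.ball ((1 / 2 : ℝ) • z + (1 / 2 : ℝ) • x₀) (r / 2) ⊆
        (Metric.closedBall x₀ (k : ℝ))ᶜ := by
      intro y hy hy'
      rw [Metric.mem_ball'] at hy
      rw [Metric.mem_closedBall] at hy'
      have h1 := hc z
      rw [hz] at h1
      linarith [dist_triangle ((1 / 2 : ℝ) • z + (1 / 2 : ℝ) • x₀) y x₀]
    have h1 := setIntegral_mono_set (hh.integrableOn (s := (Metric.closedBall x₀ (k : ℝ))ᶜ))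
      (Eventually.of_forall hpos) hsub.eventuallyLE
    -- Tail mass and L¹ error are each below δV/4; squaring their sum δV/2 yields exactly the δ/4
    -- needed on the sphere.
    have h2 := hbound z (δ * V / 2) (by positivity) ((hdom z hz.le).trans (by linarith))
    refine h2.trans_eq ?_
    field_simp
    norm_num
  · have h1 := setIntegral_le_integral (s := Metric.ball ((1 / 2 : ℝ) • z + (1 / 2 : ℝ) • x₀) (r / 2))
      hh (Eventually.of_forall hpos)
    have h2 : 0 ≤ ∫ y, h y ∂μ := integral_nonneg hpos
    exact (hbound z I₀ (by positivity) ((hdom z hz).trans (by linarith))).trans (le_max_right _ _)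

end Domination

end IsLogConcave

/-! ### Exponential and polynomial weights. -/

section Weights

/-- Comparison with (1 + ‖x‖)⁻ᴺ for N = dim + 1, through tᴺ/N! ≤ eᵗ at t = c(1 + ‖x‖). -/
theorem integrable_exp_neg_mul_norm {E : Type*} [NormedAddCommGroup E] [NormedSpace ℝ E]
    [FiniteDimensional ℝ E] [MeasurableSpace E] [BorelSpace E] (μ : Measure E)
    [μ.IsAddHaarMeasure] {c : ℝ} (hc : 0 < c) : Integrable (fun x => Real.exp (-c * ‖x‖)) μ := by
  set N := Module.finrank ℝ E + 1 with hN
  have h1 : Integrable (fun x : E => (1 + ‖x‖) ^ (-(N : ℝ))) μ :=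
    integrable_one_add_norm (by rw [hN]; push_cast; linarith)
  refine (h1.const_mul (Real.exp c * (N.factorial / c ^ N))).mono'
    (by fun_prop) (Eventually.of_forall fun x => ?_)
  have hpos : 0 < 1 + ‖x‖ := by positivity
  have h2 := Real.pow_div_factorial_le_exp (c * (1 + ‖x‖)) (by positivity) N
  rw [Real.norm_of_nonneg (Real.exp_pos _).le, Real.rpow_neg hpos.le, Real.rpow_natCast]
  have h3 : Real.exp (-c * ‖x‖) = Real.exp c * (Real.exp (c * (1 + ‖x‖)))⁻¹ := by
    rw [← Real.exp_neg, ← Real.exp_add]; congr 1; ring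
  rw [h3, mul_assoc]
  refine mul_le_mul_of_nonneg_left ?_ (Real.exp_pos _).le
  calc (Real.exp (c * (1 + ‖x‖)))⁻¹ ≤ ((c * (1 + ‖x‖)) ^ N / N.factorial)⁻¹ :=
        inv_anti₀ (by positivity) h2
    _ = N.factorial / c ^ N * ((1 + ‖x‖) ^ N)⁻¹ := by
        rw [mul_pow, inv_div, div_eq_mul_inv, mul_inv]; ring

/-- Polynomials grow more slowly than any exponential. -/
theorem MvPolynomial.exists_abs_eval_le_exp {d : ℕ} (Q : MvPolynomial (Fin d) ℝ) :
    ∀ c : ℝ, 0 < c → ∃ C : ℝ, ∀ x : EuclideanSpace ℝ (Fin d),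
      |MvPolynomial.eval (fun i => x i) Q| ≤ C * Real.exp (c * ‖x‖) := by
  induction Q using MvPolynomial.induction_on with
  | C a =>
    refine fun c hc => ⟨|a|, fun x => ?_⟩
    rw [MvPolynomial.eval_C]
    exact le_mul_of_one_le_right (abs_nonneg a) (Real.one_le_exp (by positivity))
  | add p q hp hq =>
    intro c hc
    obtain ⟨A, hA⟩ := hp c hc
    obtain ⟨B, hB⟩ := hq c hc
    refine ⟨A + B, fun x => ?_⟩
    rw [map_add, add_mul]
    exact (abs_add_le _ _).trans (add_le_add (hA x) (hB x))
  | mul_X p i hp =>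
    intro c hc
    -- The rate is shared equally between `p` and the new variable, hence the induction over all
    -- `c`.
    obtain ⟨A, hA⟩ := hp (c / 2) (by positivity)
    refine ⟨A * (2 / c), fun x => ?_⟩
    rw [map_mul, MvPolynomial.eval_X, abs_mul]
    have h1 : |x i| ≤ 2 / c * Real.exp (c / 2 * ‖x‖) := by
      have h2 : |x i| ≤ ‖x‖ := PiLp.norm_apply_le x i
      have h3 : c / 2 * ‖x‖ ≤ Real.exp (c / 2 * ‖x‖) := by
        linarith [Real.add_one_le_exp (c / 2 * ‖x‖)]
      calc |x i| ≤ 2 / c * (c / 2 * ‖x‖) := by rw [← mul_assoc]; field_simp; exact h2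
        _ ≤ _ := mul_le_mul_of_nonneg_left h3 (by positivity)
    calc |MvPolynomial.eval (fun i => x i) p| * |x i|
        ≤ (A * Real.exp (c / 2 * ‖x‖)) * (2 / c * Real.exp (c / 2 * ‖x‖)) :=
          mul_le_mul (hA x) h1 (abs_nonneg _) ((abs_nonneg _).trans (hA x))
      _ = A * (2 / c) * (Real.exp (c / 2 * ‖x‖) * Real.exp (c / 2 * ‖x‖)) := by ring
      _ = _ := by rw [← Real.exp_add]; congr 2; ring

theorem abs_inner_le_of_mem_closedBall {E : Type*} [NormedAddCommGroup E]
    [InnerProductSpace ℝ E] {θ x₀ x : E} {K : ℝ} (hx : x ∈ Metric.closedBall x₀ K) :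
    |inner ℝ θ x| ≤ ‖θ‖ * (‖x₀‖ + K) := by
  refine (abs_real_inner_le_norm θ x).trans (mul_le_mul_of_nonneg_left ?_ (norm_nonneg _))
  rw [Metric.mem_closedBall, dist_eq_norm] at hx
  linarith [norm_sub_norm_le x x₀]

end Weights

/-! ### Weighted convergence of the densities. -/

section WeightedConvergence

variable {E : Type*} [NormedAddCommGroup E] [InnerProductSpace ℝ E] [FiniteDimensional ℝ E]
  [MeasurableSpace E] [BorelSpace E] {μ : Measure E} [μ.IsAddHaarMeasure]
  {P : ProbabilityMeasure E} {Pn : ℕ → ProbabilityMeasure E} {f : E → ℝ} {fn : ℕ → E → ℝ}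

/-- Exponentially tilted log-concave densities have a common exponential majorant along a weakly
convergent sequence, if the tilted limit density is integrable. -/
theorem exists_eventually_exp_inner_mul_le (hf : IsLogConcave f) (hfn : ∀ n, IsLogConcave (fn n))
    (hP : (P : Measure E) = μ.withDensity fun x => ENNReal.ofReal (f x))
    (hPn : ∀ n, (Pn n : Measure E) = μ.withDensity fun x => ENNReal.ofReal (fn n x))
    (hweak : Tendsto Pn atTop (𝓝 P)) {θ : E}
    (hθ : Integrable (fun x => Real.exp (inner ℝ θ x) * f x) μ) :
    ∃ C c : ℝ, 0 < C ∧ 0 < c ∧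
      ∀ᶠ n in atTop, ∀ x, Real.exp (inner ℝ θ x) * fn n x ≤ C * Real.exp (-c * ‖x‖) := by
  have := FiniteDimensional.proper_real E
  have hi := integrable_of_eq_withDensity hf hP
  have hin := fun n => integrable_of_eq_withDensity (hfn n) (hPn n)
  have hcont : Continuous fun x : E => Real.exp (inner ℝ θ x) := by fun_prop
  obtain ⟨x₀, r, t, hr, ht, hlow⟩ := exists_ball_le_of_eq_withDensity hf hP
  have hlown := eventually_lt_of_tendsto hfn hP hPn hweak (x₀ := x₀) (r := r / 3) (s := t / 2)
    (t := t) (by positivity) (by positivity) (by linarith)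
    (fun x hx => hlow x (by convert hx using 2; ring))
  have hloc : ∀ n, LocallyIntegrable (fun x => Real.exp (inner ℝ θ x) * fn n x) μ := fun n => by
    rw [locallyIntegrable_iff]
    exact fun k hk => ((hin n).integrableOn (s := k)).continuousOn_mul hcont.continuousOn hk
  -- On a bounded set the tilt is bounded, so unweighted L¹ convergence suffices.
  have hlim : ∀ K, Tendsto (fun n => ∫ y in Metric.closedBall x₀ K,
      |Real.exp (inner ℝ θ y) * fn n y - Real.exp (inner ℝ θ y) * f y| ∂μ) atTop (𝓝 0) := by
    intro K
    have h1 := (tendsto_integral_abs_sub hf hfn hP hPn hweak).const_mul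
      (Real.exp (‖θ‖ * (‖x₀‖ + K)))
    rw [mul_zero] at h1
    refine squeeze_zero (fun n => integral_nonneg fun y => abs_nonneg _) (fun n => ?_) h1
    have h2 : Integrable (fun y => |fn n y - f y|) μ := ((hin n).sub hi).abs
    calc ∫ y in Metric.closedBall x₀ K,
          |Real.exp (inner ℝ θ y) * fn n y - Real.exp (inner ℝ θ y) * f y| ∂μ
        ≤ ∫ y in Metric.closedBall x₀ K, Real.exp (‖θ‖ * (‖x₀‖ + K)) * |fn n y - f y| ∂μ := by
          refine setIntegral_mono_on
            (((hloc n).integrableOn_isCompact (isCompact_closedBall _ _)).sub hθ.integrableOn).abs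
            (h2.const_mul _).integrableOn measurableSet_closedBall fun y hy => ?_
          rw [← mul_sub, abs_mul, Real.abs_exp]
          exact mul_le_mul_of_nonneg_right (Real.exp_le_exp.2
            ((le_abs_self _).trans (abs_inner_le_of_mem_closedBall hy))) (abs_nonneg _)
      _ ≤ ∫ y, Real.exp (‖θ‖ * (‖x₀‖ + K)) * |fn n y - f y| ∂μ :=
          setIntegral_le_integral (h2.const_mul _)
            (Eventually.of_forall fun y => mul_nonneg (Real.exp_pos _).le (abs_nonneg _))
      _ = _ := integral_const_mul _ _
  obtain ⟨C, c, hC, hc, hCc⟩ := IsLogConcave.exists_eventually_le_mul_exp_neg_dist (μ := μ)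
    (h := fun x => Real.exp (inner ℝ θ x) * f x)
    (hn := fun n x => Real.exp (inner ℝ θ x) * fn n x) (x₀ := x₀) (r := r / 3)
    (δ := Real.exp (-(‖θ‖ * (‖x₀‖ + r / 3))) * (t / 2)) hθ
    (fun x => mul_nonneg (Real.exp_pos _).le (hf.nonneg x))
    (fun n => (IsLogConcave.exp_inner θ).mul (hfn n)) hloc (by positivity) (by positivity)
    (by
      filter_upwards [hlown] with n hn y hy
      refine mul_le_mul (Real.exp_le_exp.2 ?_) (hn y hy).le (by positivity) (Real.exp_pos _).le
      exact (abs_le.1 (abs_inner_le_of_mem_closedBall (Metric.ball_subset_closedBall hy))).1)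
    hlim
  -- The extra factor pays for moving the centre from `x₀` to 0.
  refine ⟨C * Real.exp (c * ‖x₀‖), c, by positivity, hc, ?_⟩
  filter_upwards [hCc] with n hn x
  refine (hn x).trans ?_
  rw [mul_assoc, ← Real.exp_add]
  refine mul_le_mul_of_nonneg_left (Real.exp_le_exp.2 ?_) hC.le
  have h1 : ‖x‖ - ‖x₀‖ ≤ dist x x₀ := by rw [dist_eq_norm]; exact norm_sub_norm_le x x₀
  nlinarith

/-- Weighted `L¹` convergence of log-concave densities, for weights which are the product of an
exponential and a function of subexponential growth. -/
theorem tendsto_lintegral_exp_inner_mul_abs_sub (hf : IsLogConcave f)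
    (hfn : ∀ n, IsLogConcave (fn n))
    (hP : (P : Measure E) = μ.withDensity fun x => ENNReal.ofReal (f x))
    (hPn : ∀ n, (Pn n : Measure E) = μ.withDensity fun x => ENNReal.ofReal (fn n x))
    (hweak : Tendsto Pn atTop (𝓝 P)) {θ : E}
    (hθ : Integrable (fun x => Real.exp (inner ℝ θ x) * f x) μ) {q : E → ℝ} (hq : Continuous q)
    (hqexp : ∀ c : ℝ, 0 < c → ∃ C : ℝ, ∀ x, |q x| ≤ C * Real.exp (c * ‖x‖)) :
    Tendsto (fun n => ∫⁻ x, ENNReal.ofReal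
        (Real.exp (inner ℝ θ x) * |q x| * |fn n x - f x|) ∂μ) atTop (𝓝 0) ∧
      Integrable (fun x => Real.exp (inner ℝ θ x) * |q x| * f x) μ := by
  have hi := integrable_of_eq_withDensity hf hP
  have hin := fun n => integrable_of_eq_withDensity (hfn n) (hPn n)
  have hmw : Continuous fun x : E => Real.exp (inner ℝ θ x) * |q x| := by fun_prop
  obtain ⟨C₁, c₁, hC₁, hc₁, h₁⟩ := exists_eventually_exp_inner_mul_le hf hfn hP hPn hweak hθ
  -- The constant sequence yields the majorant for `f` itself.
  obtain ⟨C₂, c₂, hC₂, hc₂, h₂⟩ := exists_eventually_exp_inner_mul_le (Pn := fun _ => P) hf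
    (fun _ : ℕ => hf) hP (fun _ => hP) tendsto_const_nhds hθ
  obtain ⟨-, h₂⟩ := h₂.exists
  set c := min c₁ c₂ with hcdef
  have hc : 0 < c := lt_min hc₁ hc₂
  -- `q` uses up half of the decay rate; the other half keeps the majorant integrable.
  obtain ⟨D, hD⟩ := hqexp (c / 2) (by positivity)
  have hbound : ∀ (g : E → ℝ) (C c' : ℝ), 0 < C → c ≤ c' → (∀ x, 0 ≤ g x) →
      (∀ x, Real.exp (inner ℝ θ x) * g x ≤ C * Real.exp (-c' * ‖x‖)) →
      ∀ x, Real.exp (inner ℝ θ x) * |q x| * g x ≤ C * D * Real.exp (-(c / 2) * ‖x‖) := by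
    intro g C c' hC hcc' hg hgb x
    have h3 : Real.exp (inner ℝ θ x) * g x ≤ C * Real.exp (-c * ‖x‖) :=
      (hgb x).trans (mul_le_mul_of_nonneg_left
        (Real.exp_le_exp.2 (by nlinarith [norm_nonneg x])) hC.le)
    calc Real.exp (inner ℝ θ x) * |q x| * g x = Real.exp (inner ℝ θ x) * g x * |q x| := by ring
      _ ≤ C * Real.exp (-c * ‖x‖) * (D * Real.exp (c / 2 * ‖x‖)) :=
          mul_le_mul h3 (hD x) (abs_nonneg _) (by positivity)
      _ = C * D * (Real.exp (-c * ‖x‖) * Real.exp (c / 2 * ‖x‖)) := by ring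
      _ = _ := by rw [← Real.exp_add]; congr 2; ring
  have hexp := integrable_exp_neg_mul_norm μ (show 0 < c / 2 by positivity)
  have hb₂ := hbound f C₂ c₂ hC₂ (min_le_right _ _) hf.nonneg h₂
  refine ⟨?_, (hexp.const_mul (C₂ * D)).mono'
    (hmw.aestronglyMeasurable.mul hi.aestronglyMeasurable) (Eventually.of_forall fun x => ?_)⟩
  swap
  · rw [Real.norm_of_nonneg (mul_nonneg (by positivity) (hf.nonneg x))]
    exact hb₂ x
  have hmeas : TendstoInMeasure μ fn atTop f := by
    refine tendstoInMeasure_of_tendsto_eLpNorm (p := 1) one_ne_zero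
      (fun n => (hin n).aestronglyMeasurable) hi.aestronglyMeasurable ?_
    have h3 : ∀ n, eLpNorm (fn n - f) 1 μ = ENNReal.ofReal (∫ x, |fn n x - f x| ∂μ) := fun n => by
      rw [eLpNorm_one_eq_lintegral_enorm, ← ofReal_integral_norm_eq_lintegral_enorm ((hin n).sub hi)]
      rfl
    simp_rw [h3]
    simpa using ENNReal.tendsto_ofReal (tendsto_integral_abs_sub hf hfn hP hPn hweak)
  -- Convergence in measure gives a.e. convergence only along further subsequences, which is enough
  -- for a limit of numbers.
  refine tendsto_of_subseq_tendsto fun ns hns => ?_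
  obtain ⟨ms, hms, hae⟩ := TendstoInMeasure.exists_seq_tendsto_ae
    (fun ε hε => (hmeas ε hε).comp hns : TendstoInMeasure μ (fun n => fn (ns n)) atTop f)
  refine ⟨ms, ?_⟩
  have hev : ∀ᶠ n in atTop, ∀ x,
      Real.exp (inner ℝ θ x) * fn (ns (ms n)) x ≤ C₁ * Real.exp (-c₁ * ‖x‖) :=
    (hns.comp hms.tendsto_atTop).eventually h₁
  rw [show (0 : ℝ≥0∞) = ∫⁻ _, 0 ∂μ by simp]
  refine tendsto_lintegral_filter_of_dominated_convergence'
    (fun x => ENNReal.ofReal ((C₁ * D + C₂ * D) * Real.exp (-(c / 2) * ‖x‖)))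
    (Eventually.of_forall fun n => ?_) ?_ ?_ ?_
  · exact (hmw.aemeasurable.mul ((hin _).sub hi).abs.aemeasurable).ennreal_ofReal
  · filter_upwards [hev] with n hn
    refine Eventually.of_forall fun x => ENNReal.ofReal_le_ofReal ?_
    have hb₁ := hbound _ C₁ c₁ hC₁ (min_le_left _ _) (hfn (ns (ms n))).nonneg hn x
    have habs : |fn (ns (ms n)) x - f x| ≤ fn (ns (ms n)) x + f x :=
      abs_sub_le_iff.2 ⟨by linarith [hf.nonneg x], by linarith [(hfn (ns (ms n))).nonneg x]⟩
    have hw : 0 ≤ Real.exp (inner ℝ θ x) * |q x| := by positivity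
    have := mul_le_mul_of_nonneg_left habs hw
    rw [mul_add] at this
    linarith [hb₂ x]
  · exact (hexp.const_mul _).lintegral_lt_top.ne
  · filter_upwards [hae] with x hx
    have h3 : Tendsto (fun n => |fn (ns (ms n)) x - f x|) atTop (𝓝 0) := by
      simpa using (hx.sub_const (f x)).abs
    simpa using ENNReal.tendsto_ofReal (h3.const_mul (Real.exp (inner ℝ θ x) * |q x|))

/-- Lower semicontinuity of weighted integrals. -/
theorem lintegral_le_liminf_lintegral_of_tendsto (hf : IsLogConcave f)
    (hfn : ∀ n, IsLogConcave (fn n))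
    (hP : (P : Measure E) = μ.withDensity fun x => ENNReal.ofReal (f x))
    (hPn : ∀ n, (Pn n : Measure E) = μ.withDensity fun x => ENNReal.ofReal (fn n x))
    (hweak : Tendsto Pn atTop (𝓝 P)) {w : E → ℝ} (hw : Continuous w) (hw0 : ∀ x, 0 ≤ w x) :
    ∫⁻ x, ENNReal.ofReal (w x * f x) ∂μ ≤
      liminf (fun n => ∫⁻ x, ENNReal.ofReal (w x * fn n x) ∂μ) atTop := by
  refine le_trans (lintegral_mono_ae ?_) (lintegral_liminf_le' fun n =>
    (hw.aemeasurable.mul ((hfn n).aemeasurable μ)).ennreal_ofReal)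
  filter_upwards [ae_tendsto_max_sub_zero hf hfn hP hPn hweak] with x hx
  -- `f - (f - fn)⁺` is min(f, fn): it lies below `fn` and tends to `f` almost everywhere, so
  -- Fatou's lemma applies.
  have h1 : Tendsto (fun n => ENNReal.ofReal (w x * (f x - max (f x - fn n x) 0))) atTop
      (𝓝 (ENNReal.ofReal (w x * f x))) := by
    simpa using ENNReal.tendsto_ofReal ((hx.const_sub (f x)).const_mul (w x))
  rw [← h1.liminf_eq]
  refine liminf_le_liminf (Eventually.of_forall fun n => ENNReal.ofReal_le_ofReal
    (mul_le_mul_of_nonneg_left ?_ (hw0 x)))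
  linarith [le_max_left (f x - fn n x) 0]

end WeightedConvergence

/-! ### Moments and Laplace transforms. -/

section MomentGeneratingFunction

variable {d : ℕ} {P : ProbabilityMeasure (EuclideanSpace ℝ (Fin d))}
  {f : EuclideanSpace ℝ (Fin d) → ℝ}

theorem mem_mgfDomain_iff (hf : HasLogConcaveDensity P f) (θ : EuclideanSpace ℝ (Fin d)) :
    θ ∈ mgfDomain P ↔ ∫⁻ x, ENNReal.ofReal (Real.exp (inner ℝ θ x) * f x) < ∞ := by
  rw [mgfDomain, Set.mem_ofPred_eq, hf.2, lintegral_withDensity_eq_lintegral_mul₀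
    (hf.1.isLogConcave.aemeasurable volume).ennreal_ofReal
    (Measurable.aemeasurable (by fun_prop))]
  refine iff_of_eq (congrArg (· < ∞) (lintegral_congr fun x => ?_))
  rw [Pi.mul_apply, ENNReal.ofReal_mul (Real.exp_pos _).le, mul_comm]

theorem integrable_of_mem_mgfDomain (hf : HasLogConcaveDensity P f)
    {θ : EuclideanSpace ℝ (Fin d)} (hθ : θ ∈ mgfDomain P) :
    Integrable (fun x => Real.exp (inner ℝ θ x) * f x) := by
  refine ⟨(Continuous.aestronglyMeasurable (by fun_prop)).mul
    (hf.1.isLogConcave.aemeasurable volume).aestronglyMeasurable, ?_⟩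
  rw [hasFiniteIntegral_iff_ofReal (Eventually.of_forall fun x =>
    mul_nonneg (Real.exp_pos _).le (hf.1.isLogConcave.nonneg x))]
  exact (mem_mgfDomain_iff hf θ).1 hθ

/-- Moments are the case θ = 0 of the weighted result. -/
theorem zero_mem_mgfDomain (P : ProbabilityMeasure (EuclideanSpace ℝ (Fin d))) :
    0 ∈ mgfDomain P := by
  simp [mgfDomain]

variable {Pn : ℕ → ProbabilityMeasure (EuclideanSpace ℝ (Fin d))}
  {fn : ℕ → EuclideanSpace ℝ (Fin d) → ℝ}

theorem tendsto_lintegral_of_mem_mgfDomain (hf : HasLogConcaveDensity P f)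
    (hfn : ∀ n, HasLogConcaveDensity (Pn n) (fn n)) (hweak : Tendsto Pn atTop (𝓝 P))
    {θ : EuclideanSpace ℝ (Fin d)} (hθ : θ ∈ mgfDomain P) (Q : MvPolynomial (Fin d) ℝ) :
    Tendsto (fun n => ∫⁻ x, ENNReal.ofReal
        (Real.exp (inner ℝ θ x) * |MvPolynomial.eval (fun i => x i) Q| * |fn n x - f x|))
        atTop (𝓝 0) ∧
      Integrable fun x =>
        Real.exp (inner ℝ θ x) * |MvPolynomial.eval (fun i => x i) Q| * f x :=
  tendsto_lintegral_exp_inner_mul_abs_sub hf.1.isLogConcave (fun n => (hfn n).1.isLogConcave)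
    hf.2 (fun n => (hfn n).2) hweak (integrable_of_mem_mgfDomain hf hθ)
    (Q.continuous_eval.comp (by fun_prop)) Q.exists_abs_eval_le_exp

theorem integrable_eval_mul (hf : HasLogConcaveDensity P f) (Q : MvPolynomial (Fin d) ℝ) :
    Integrable fun x => MvPolynomial.eval (fun i => x i) Q * f x := by
  have h := (tendsto_lintegral_of_mem_mgfDomain (Pn := fun _ => P) (fn := fun _ => f) hf
    (fun _ => hf) tendsto_const_nhds (zero_mem_mgfDomain P) Q).2
  have hQ : Continuous fun x : EuclideanSpace ℝ (Fin d) => MvPolynomial.eval (fun i => x i) Q :=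
    Q.continuous_eval.comp (by fun_prop)
  refine h.mono' (hQ.aestronglyMeasurable.mul
    (hf.1.isLogConcave.aemeasurable volume).aestronglyMeasurable) (Eventually.of_forall fun x => ?_)
  rw [inner_zero_left, Real.exp_zero, one_mul, Real.norm_eq_abs, abs_mul,
    abs_of_nonneg (hf.1.isLogConcave.nonneg x)]

theorem tendsto_integral_eval_mul (hf : HasLogConcaveDensity P f)
    (hfn : ∀ n, HasLogConcaveDensity (Pn n) (fn n)) (hweak : Tendsto Pn atTop (𝓝 P))
    (Q : MvPolynomial (Fin d) ℝ) :
    Tendsto (fun n => ∫ x, MvPolynomial.eval (fun i => x i) Q * fn n x)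
      atTop (𝓝 (∫ x, MvPolynomial.eval (fun i => x i) Q * f x)) := by
  refine tendsto_integral_of_L1 _ (integrable_eval_mul hf Q).aestronglyMeasurable
    (Eventually.of_forall fun n => integrable_eval_mul (hfn n) Q) ?_
  refine (tendsto_lintegral_of_mem_mgfDomain hf hfn hweak (zero_mem_mgfDomain P) Q).1.congr
    fun n => lintegral_congr fun x => ?_
  rw [inner_zero_left, Real.exp_zero, one_mul, ← mul_sub, Real.enorm_eq_ofReal_abs, abs_mul]

theorem tendsto_lintegral_exp_of_notMem_mgfDomain (hf : HasLogConcaveDensity P f)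
    (hfn : ∀ n, HasLogConcaveDensity (Pn n) (fn n)) (hweak : Tendsto Pn atTop (𝓝 P))
    {θ : EuclideanSpace ℝ (Fin d)} (hθ : θ ∉ mgfDomain P) :
    Tendsto (fun n => ∫⁻ x, ENNReal.ofReal (Real.exp (inner ℝ θ x) * fn n x)) atTop (𝓝 ∞) := by
  rw [mem_mgfDomain_iff hf, not_lt, top_le_iff] at hθ
  have h := lintegral_le_liminf_lintegral_of_tendsto hf.1.isLogConcave
    (fun n => (hfn n).1.isLogConcave) hf.2 (fun n => (hfn n).2) hweak
    (w := fun x => Real.exp (inner ℝ θ x)) (by fun_prop) (fun x => (Real.exp_pos _).le)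
  rw [hθ] at h
  exact tendsto_of_le_liminf_of_limsup_le h le_top

/-- On the mgf domain, Fatou gives the lower bound, and `fn ≤ f + |fn - f|` with weighted
convergence for the polynomial 1 gives the upper one. -/
theorem tendsto_lintegral_exp (hf : HasLogConcaveDensity P f)
    (hfn : ∀ n, HasLogConcaveDensity (Pn n) (fn n)) (hweak : Tendsto Pn atTop (𝓝 P))
    (θ : EuclideanSpace ℝ (Fin d)) :
    Tendsto (fun n => ∫⁻ x, ENNReal.ofReal (Real.exp (inner ℝ θ x) * fn n x))
      atTop (𝓝 (∫⁻ x, ENNReal.ofReal (Real.exp (inner ℝ θ x) * f x))) := by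
  by_cases hθ : θ ∈ mgfDomain P
  swap
  · have h := tendsto_lintegral_exp_of_notMem_mgfDomain hf hfn hweak hθ
    rw [mem_mgfDomain_iff hf, not_lt, top_le_iff] at hθ
    rwa [hθ]
  have h1 := (tendsto_lintegral_of_mem_mgfDomain hf hfn hweak hθ 1).1
  simp only [map_one, abs_one, mul_one] at h1
  have hw : Continuous fun x => Real.exp (inner ℝ θ x) := by fun_prop
  refine tendsto_of_le_liminf_of_limsup_le
    (lintegral_le_liminf_lintegral_of_tendsto hf.1.isLogConcave
      (fun n => (hfn n).1.isLogConcave) hf.2 (fun n => (hfn n).2) hweak hw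
      fun x => (Real.exp_pos _).le) ?_
  have h2 := h1.const_add (∫⁻ x, ENNReal.ofReal (Real.exp (inner ℝ θ x) * f x))
  rw [add_zero] at h2
  rw [← h2.limsup_eq]
  refine limsup_le_limsup (Eventually.of_forall fun n => ?_)
  have h3 : AEMeasurable (fun x => ENNReal.ofReal (Real.exp (inner ℝ θ x) * f x)) :=
    (hw.aemeasurable.mul (hf.1.isLogConcave.aemeasurable volume)).ennreal_ofReal
  dsimp only
  rw [← lintegral_add_left' h3]
  refine lintegral_mono fun x => ?_
  rw [← ENNReal.ofReal_add (mul_nonneg (Real.exp_pos _).le (hf.1.isLogConcave.nonneg x))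
    (by positivity), ← mul_add]
  exact ENNReal.ofReal_le_ofReal (mul_le_mul_of_nonneg_left
    (by linarith [le_abs_self (fn n x - f x)]) (Real.exp_pos _).le)

end MomentGeneratingFunction

theorem mainTheorem2 (d : ℕ)
    (P : ProbabilityMeasure (EuclideanSpace ℝ (Fin d)))
    (Pn : ℕ → ProbabilityMeasure (EuclideanSpace ℝ (Fin d)))
    (f : EuclideanSpace ℝ (Fin d) → ℝ)
    (fn : ℕ → EuclideanSpace ℝ (Fin d) → ℝ)
    (hf : HasLogConcaveDensity P f)
    (hfn : ∀ n, HasLogConcaveDensity (Pn n) (fn n))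
    (hweak : Tendsto Pn atTop (𝓝 P)) :
    -- weighted convergence of the densities, and finiteness, on the domain of the mgf
    (∀ θ ∈ mgfDomain P, ∀ Q : MvPolynomial (Fin d) ℝ,
      Tendsto (fun n => ∫⁻ x, ENNReal.ofReal
          (Real.exp (inner ℝ θ x) * |MvPolynomial.eval (fun i => x i) Q| * |fn n x - f x|))
        atTop (𝓝 0) ∧
      ∫⁻ x, ENNReal.ofReal
          (Real.exp (inner ℝ θ x) * |MvPolynomial.eval (fun i => x i) Q| * f x) < ∞) ∧
    -- outside the domain of the mgf
    (∀ θ ∉ mgfDomain P,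
      Tendsto (fun n => ∫⁻ x, ENNReal.ofReal (Real.exp (inner ℝ θ x) * fn n x))
        atTop (𝓝 ∞)) ∧
    -- all moments exist and converge
    (∀ Q : MvPolynomial (Fin d) ℝ,
      Integrable (fun x => MvPolynomial.eval (fun i => x i) Q * f x) ∧
      (∀ n, Integrable (fun x => MvPolynomial.eval (fun i => x i) Q * fn n x)) ∧
      Tendsto (fun n => ∫ x, MvPolynomial.eval (fun i => x i) Q * fn n x)
        atTop (𝓝 (∫ x, MvPolynomial.eval (fun i => x i) Q * f x))) ∧
    -- the Laplace transforms converge pointwise, as functions with values in `[0, ∞]`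
    (∀ θ : EuclideanSpace ℝ (Fin d),
      Tendsto (fun n => ∫⁻ x, ENNReal.ofReal (Real.exp (inner ℝ θ x) * fn n x))
        atTop (𝓝 (∫⁻ x, ENNReal.ofReal (Real.exp (inner ℝ θ x) * f x)))) := by
  refine ⟨fun θ hθ Q => ?_, fun θ hθ => tendsto_lintegral_exp_of_notMem_mgfDomain hf hfn hweak hθ,
    fun Q => ⟨integrable_eval_mul hf Q, fun n => integrable_eval_mul (hfn n) Q,
      tendsto_integral_eval_mul hf hfn hweak Q⟩, tendsto_lintegral_exp hf hfn hweak⟩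
  have h := tendsto_lintegral_of_mem_mgfDomain hf hfn hweak hθ Q
  exact ⟨h.1, h.2.lintegral_lt_top⟩
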